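/- Let $n,d\ge 1$ and $r\ge 2$. For a real matrix $M$ with $d$ columns let $\mathrm{conv}(M)\subseteq\mathbb R^d$ be the convex hull of its rows, and let $\|\cdot\|_2$ be the Euclidean norm. For $V\in\mathbb R^{m\times d}$, $u\in\mathbb R^d$ and $U\in\mathbb R^{k\times d}$ with rows $u_1,\dots,u_k$ put $$\mathscr D(u;V)=\min_{\pi\in\Delta^m}\|u-V^{\mathsf T}\pi\|_2^2,\qquad \mathscr D(U;V)=\sum_{l=1}^k\mathscr D(u_l;V),$$ where $\Delta^m=\{\pi\in\mathbb R^m_{\ge0}:\sum_j\pi_j=1\}$. For $H_0,H\in\mathbb R^{r\times d}$ with rows $h_{0,l}$ and $h_l$ put $\mathscr L(H_0,H)=\sum_{l=1}^r\min_{l'\le r}\|h_{0,l}-h_{l'}\|_2^2$. For a nonzero matrix $M$ let $\sigma_{\max}(M)$ and $\sigma_{\min}(M)$ be its largest and smallest nonzero singular values, and $\kappa(M)=\sigma_{\max}(M)/\sigma_{\min}(M)$. Let $X=X_0+Z\in\mathbb R^{n\times d}$ with $X_0=W_0H_0$, where $W_0\in\mathbb R^{n\times r}$ has all its rows in $\Delta^r$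 and $H_0\in\mathbb R^{r\times d}$ has linearly independent rows. Let $\alpha>0$ and $\mu>0$, and assume the following. 1. (The factorization is $\alpha$-unique.) For every $H\in\mathbb R^{r\times d}$ with $\mathrm{conv}(X_0)\subseteq\mathrm{conv}(H)$, $$\mathscr D(H;X_0)^{1/2}\ \ge\ \mathscr D(H_0;X_0)^{1/2}+\alpha\big\{\mathscr D(H;H_0)^{1/2}+\mathscr D(H_0;H)^{1/2}\big\}.$$ 2. ($\mathrm{conv}(X_0)$ has internal radius at least $\mu$.) There are $z_0\in\mathbb R^d$ and $U\in\mathbb R^{d\times(r-1)}$ with $U^{\mathsf T}U=I_{r-1}$ such that $z_0+Ub\in\mathrm{conv}(X_0)$ for all $b\in\mathbb R^{r-1}$ with $\|b\|_2\le\mu$. Let $\delta=\max_{i\le n}\|Z_{i,\cdot}\|_2$, and let $\widehat H$ be any minimizer of $\mathscr D(H;X)$ over all $H\in\mathbb R^{r\times d}$ that satisfy $\mathscr D(x_i;H)\le\delta^2$ for every row $x_i$ of $X$. If $$\max_{i\le n}\|Z_{i,\cdot}\|_2\le\frac{\alpha\mu}{30\,r^{3/2}},$$ then $$\mathscr L(H_0,\widehat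 H)\ \le\ \frac{C_*^2\,r^5}{\alpha^2}\,\max_{i\le n}\|Z_{i,\cdot}\|_2^2,\qquad C_*=120\,\frac{\sigma_{\max}(H_0)}{\mu}\,\max\Big(1,\frac{\kappa(H_0)}{\sqrt r}\Big).$$ -/

import Mathlib

namespace Archetypal

noncomputable section

/-- The `i`-th row of a real matrix, as a vector of Euclidean space. -/
def rowVec {m d : ℕ} (M : Matrix (Fin m) (Fin d) ℝ) (i : Fin m) : EuclideanSpace ℝ (Fin d) :=
  WithLp.toLp 2 (M i)

/-- The convex hull of the rows of a matrix. -/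
def conv {m d : ℕ} (M : Matrix (Fin m) (Fin d) ℝ) : Set (EuclideanSpace ℝ (Fin d)) :=
  convexHull ℝ (Set.range (rowVec M))

/-- The square loss `D(x, y) = ‖x - y‖²`. -/
def sqLoss {d : ℕ} (x y : EuclideanSpace ℝ (Fin d)) : ℝ := ‖x - y‖ ^ 2

/-- `𝒟(u; V) = min {D(u, Vᵀ π) : π ∈ Δᵐ}`, where `Vᵀ π = ∑ j, π j • (row j of V)`.
For `m ≥ 1` the infimum is a minimum, since the simplex is compact. -/
def vecLoss {m d : ℕ} (u : EuclideanSpace ℝ (Fin d)) (V : Matrix (Fin m) (Fin d) ℝ) : ℝ :=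
  sInf ((fun π : Fin m → ℝ => sqLoss u (∑ j, π j • rowVec V j)) '' stdSimplex ℝ (Fin m))

/-- `𝒟(U; V)`, the sum of `𝒟(u; V)` over the rows `u` of `U`. -/
def matLoss {k m d : ℕ} (U : Matrix (Fin k) (Fin d) ℝ) (V : Matrix (Fin m) (Fin d) ℝ) : ℝ :=
  ∑ l, vecLoss (rowVec U l) V

/-- The estimation error `ℒ(H₀, H) = ∑ l, min l', D(row l of H₀, row l' of H)`. -/
def archLoss {r d : ℕ} (H₀ H : Matrix (Fin r) (Fin d) ℝ) : ℝ :=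
  ∑ l, ⨅ l', sqLoss (rowVec H₀ l) (rowVec H l')

/-- The largest Euclidean norm of a row. -/
def maxRowNorm {n d : ℕ} (Z : Matrix (Fin n) (Fin d) ℝ) : ℝ := ⨆ i, ‖rowVec Z i‖

/-- The rows of `W` are probability vectors. -/
def IsRowStochastic {n r : ℕ} (W : Matrix (Fin n) (Fin r) ℝ) : Prop :=
  ∀ i, W i ∈ stdSimplex ℝ (Fin r)

/-- The factorization `X₀ = W₀ H₀` satisfies uniqueness with parameter `α`. -/
def IsAlphaUnique {n r d : ℕ} (α : ℝ) (W₀ : Matrix (Fin n) (Fin r) ℝ)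
    (H₀ : Matrix (Fin r) (Fin d) ℝ) : Prop :=
  ∀ H : Matrix (Fin r) (Fin d) ℝ, conv (W₀ * H₀) ⊆ conv H →
    √(matLoss H₀ (W₀ * H₀)) + α * (√(matLoss H H₀) + √(matLoss H₀ H))
      ≤ √(matLoss H (W₀ * H₀))

/-- `S` contains a `k`-dimensional ball of radius `μ`, namely `z₀ + U B_k(μ)` for some point `z₀`
and some matrix `U` with orthonormal columns. -/
def ContainsBall {d : ℕ} (k : ℕ) (μ : ℝ) (S : Set (EuclideanSpace ℝ (Fin d))) : Prop :=
  ∃ (z₀ : EuclideanSpace ℝ (Fin d)) (U : Matrix (Fin d) (Fin k) ℝ), U.transpose * U = 1 ∧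
    ∀ b : EuclideanSpace ℝ (Fin k), ‖b‖ ≤ μ → z₀ + Matrix.toEuclideanLin U b ∈ S

/-- `conv X₀` has internal radius (at least) `μ` when the number of archetypes is `r`. -/
def HasInternalRadius {n d : ℕ} (r : ℕ) (μ : ℝ) (X₀ : Matrix (Fin n) (Fin d) ℝ) : Prop :=
  ContainsBall (r - 1) μ (conv X₀)

/-- The constraint set of the estimation problem: `𝒟(xᵢ; H) ≤ δ²` for all rows `xᵢ` of `X`. -/
def feasible {n d : ℕ} (r : ℕ) (X : Matrix (Fin n) (Fin d) ℝ) (δ : ℝ) :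
    Set (Matrix (Fin r) (Fin d) ℝ) :=
  {H | ∀ i, vecLoss (rowVec X i) H ≤ δ ^ 2}

/-- `Hhat` solves: minimize `𝒟(H; X)` subject to `𝒟(xᵢ; H) ≤ δ²` for all `i`. -/
def IsEstimator {n r d : ℕ} (X : Matrix (Fin n) (Fin d) ℝ) (δ : ℝ)
    (Hhat : Matrix (Fin r) (Fin d) ℝ) : Prop :=
  Hhat ∈ feasible r X δ ∧ IsMinOn (fun H => matLoss H X) (feasible r X δ) Hhat

/-- The largest singular value. -/
def sigmaMax {m d : ℕ} (M : Matrix (Fin m) (Fin d) ℝ) : ℝ :=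
  (Matrix.toEuclideanLin M).singularValues 0

/-- The smallest nonzero singular value. The singular values are listed in decreasing order,
starting at index `0`, and exactly the first `M.rank` of them are nonzero. -/
def sigmaMin {m d : ℕ} (M : Matrix (Fin m) (Fin d) ℝ) : ℝ :=
  (Matrix.toEuclideanLin M).singularValues (M.rank - 1)

/-- The condition number. -/
def kappa {m d : ℕ} (M : Matrix (Fin m) (Fin d) ℝ) : ℝ := sigmaMax M / sigmaMin M

/-- The constant `C⋆ = 120 (σ_max(H₀) / μ) max(1, κ(H₀) / √r)`. -/
def Cstar {r d : ℕ} (H₀ : Matrix (Fin r) (Fin d) ℝ) (μ : ℝ) : ℝ :=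
  120 * (sigmaMax H₀ / μ) * max 1 (kappa H₀ / √(r : ℝ))

end

end Archetypal

namespace Archetypal

open Metric

/-! Write `C` for the hull of the noiseless data and `S` for the direction space of the ball of
radius `μ` inside it, so that `dim S = r - 1`. Feasibility puts `C` within `2δ` of the hull of the
estimated points `hhat`. The true archetypes are feasible too, so optimality says that the distances
from `hhat` to `C` exceed those from `h₀` by at most `2δ√r` in the Euclidean norm. Uniqueness cannot
be applied to `hhat` itself, whose hull need not contain `C`.

The remedy is to replace `hhat` by `h'`: project onto `z₀ + S` and dilate about `z₀` by `1 + t`,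
with `t = 2δ / (μ - 2δ)`. The ball in `C` makes this dilation enough for the hull of `h'` to contain
`C` (`mem_convexHull_dilation`), while distances to `C` grow only by `O(δD/μ)`, where `D` bounds the
distances between true archetypes (`infDist_dilation_le`). Uniqueness then bounds the distances
between the simplices of `h'` and `h₀` by `O(√r δD/(μα))`.

Two facts turn this into closeness of archetypes. The projection moved `hhat` little, because `dim S
+ 1` points whose hull nearly fills a ball of `S` must lie near `S`
(`norm_sub_orthogonalProjectionOnto_le`). And nearby simplices have nearby vertices when the true
one is well conditioned (`exists_vertex_near`), with singular values of `H₀` controlling barycentric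
coordinates. -/

/-! ### Simplex weights and Euclidean sums -/

theorem mem_convexHull_range_iff {ι E : Type*} [Fintype ι] [AddCommGroup E] [Module ℝ E]
    {f : ι → E} {x : E} :
    x ∈ convexHull ℝ (Set.range f) ↔ ∃ π ∈ stdSimplex ℝ ι, ∑ j, π j • f j = x := by
  classical
  rw [← Set.mem_image (fun π : ι → ℝ => ∑ j, π j • f j) (stdSimplex ℝ ι) x]
  have h := (Fintype.linearCombination ℝ f).image_convexHull
    (Set.range fun i : ι => (Pi.single i 1 : ι → ℝ))
  rw [convexHull_rangle_single_eq_stdSimplex, ← Set.range_comp] at h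
  have h2 : (⇑(Fintype.linearCombination ℝ f) ∘ fun i : ι => (Pi.single i 1 : ι → ℝ)) = f := by
    ext i
    simp [Fintype.linearCombination_apply_single]
  rw [h2] at h
  rw [← h]
  rfl

theorem sum_smul_mem_convexHull_range {ι E : Type*} [Fintype ι] [AddCommGroup E] [Module ℝ E]
    (f : ι → E) {π : ι → ℝ} (hπ : π ∈ stdSimplex ℝ ι) :
    ∑ j, π j • f j ∈ convexHull ℝ (Set.range f) :=
  mem_convexHull_range_iff.2 ⟨π, hπ, rfl⟩

/-- Minkowski's inequality for `s • g` and a constant vector; it aggregates pointwise distance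
bounds into `l2InfDist` bounds. -/
theorem sqrt_sum_sq_le {ι : Type*} [Fintype ι] {f g : ι → ℝ} {s c : ℝ} (hs : 0 ≤ s) (hc : 0 ≤ c)
    (hf : ∀ l, 0 ≤ f l) (hfg : ∀ l, f l ≤ s * g l + c) :
    √(∑ l, f l ^ 2) ≤ s * √(∑ l, g l ^ 2) + √(Fintype.card ι) * c := by
  have h1 := norm_add_le (WithLp.toLp 2 (fun l => s * g l) : EuclideanSpace ℝ ι)
    (WithLp.toLp 2 (fun _ => c))
  have h2 : √(∑ l, (s * g l) ^ 2) = s * √(∑ l, g l ^ 2) := by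
    simp_rw [mul_pow]
    rw [← Finset.mul_sum, Real.sqrt_mul (sq_nonneg s), Real.sqrt_sq hs]
  have h3 : √(∑ _l : ι, c ^ 2) = √(Fintype.card ι) * c := by
    rw [Finset.sum_const, nsmul_eq_mul, Real.sqrt_mul (Nat.cast_nonneg _), Real.sqrt_sq hc]
    rfl
  simp only [EuclideanSpace.norm_eq, PiLp.add_apply, Real.norm_eq_abs, sq_abs] at h1
  rw [h2, h3] at h1
  refine le_trans (Real.sqrt_le_sqrt (Finset.sum_le_sum fun l _ => ?_)) h1
  exact pow_le_pow_left₀ (hf l) (hfg l) 2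

theorem le_sqrt_sum_sq {ι : Type*} [Fintype ι] (f : ι → ℝ) (l : ι) :
    f l ≤ √(∑ l, f l ^ 2) :=
  Real.le_sqrt_of_sq_le (Finset.single_le_sum (f := fun l => f l ^ 2)
    (fun _ _ => sq_nonneg _) (Finset.mem_univ l))

/-! ### Convex hulls, distances and balls -/

section Convexity

variable {E : Type*} [NormedAddCommGroup E]

theorem norm_sum_smul_le {ι : Type*} [Fintype ι] [NormedSpace ℝ E] {π : ι → ℝ}
    (hπ : π ∈ stdSimplex ℝ ι) {v : ι → E} {c : ℝ} (hv : ∀ j, ‖v j‖ ≤ c) :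
    ‖∑ j, π j • v j‖ ≤ c := by
  calc ‖∑ j, π j • v j‖ ≤ ∑ j, ‖π j • v j‖ := norm_sum_le _ _
    _ ≤ ∑ j, π j * c := Finset.sum_le_sum fun j _ => by
        rw [norm_smul, Real.norm_of_nonneg (hπ.1 j)]
        exact mul_le_mul_of_nonneg_left (hv j) (hπ.1 j)
    _ = c := by rw [← Finset.sum_mul, hπ.2, one_mul]

theorem norm_sub_le_of_mem_convexHull [NormedSpace ℝ E] {s : Set E} {D : ℝ} {x y : E}
    (hs : ∀ u ∈ s, ∀ v ∈ s, ‖u - v‖ ≤ D) (hx : x ∈ convexHull ℝ s) (hy : y ∈ convexHull ℝ s) :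
    ‖x - y‖ ≤ D := by
  have h1 : ∀ u ∈ s, ‖u - y‖ ≤ D := fun u hu => by
    have : convexHull ℝ s ⊆ closedBall u D := convexHull_min (fun v hv => by
      rw [mem_closedBall, dist_comm, dist_eq_norm]; exact hs u hu v hv) (convex_closedBall _ _)
    have := this hy
    rwa [mem_closedBall, dist_comm, dist_eq_norm] at this
  have : convexHull ℝ s ⊆ closedBall y D := convexHull_min (fun v hv => by
      rw [mem_closedBall, dist_eq_norm]; exact h1 v hv) (convex_closedBall _ _)
  have := this hx
  rwa [mem_closedBall, dist_eq_norm] at this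

theorem exists_mem_convexHull_range_norm_sub {ι : Type*} [Finite ι] [Nonempty ι]
    [NormedSpace ℝ E] (f : ι → E) (x : E) :
    ∃ y ∈ convexHull ℝ (Set.range f), infDist x (convexHull ℝ (Set.range f)) = ‖x - y‖ := by
  obtain ⟨y, hy, h⟩ := ((Set.finite_range f).isCompact_convexHull ℝ).exists_infDist_eq_dist
    (Set.range_nonempty f).convexHull x
  exact ⟨y, hy, by rw [h, dist_eq_norm]⟩

theorem infDist_le_norm_sub {s : Set E} {x y : E} (hy : y ∈ s) : infDist x s ≤ ‖x - y‖ := by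
  rw [← dist_eq_norm]; exact infDist_le_dist_of_mem hy

/-- A closed convex set that comes within `ε` of every point of the ball of radius `μ` contains
the ball of radius `μ - ε`. -/
theorem mem_of_closedBall_near [InnerProductSpace ℝ E] [CompleteSpace E] {K : Set E}
    (hK : Convex ℝ K) (hKc : IsClosed K) {μ ε : ℝ} (hμ : 0 ≤ μ)
    (hnear : ∀ b : E, ‖b‖ ≤ μ → ∃ k ∈ K, ‖b - k‖ ≤ ε) {y : E} (hy : ‖y‖ ≤ μ - ε) : y ∈ K := by
  obtain ⟨k₀, hk₀, -⟩ := hnear 0 (by simpa using hμ)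
  obtain ⟨p, hp, hpi⟩ := exists_norm_eq_iInf_of_complete_convex ⟨k₀, hk₀⟩ hKc.isComplete hK y
  rw [norm_eq_iInf_iff_real_inner_le_zero hK hp] at hpi
  by_contra hyK
  set u := y - p with hu
  have hu0 : 0 < ‖u‖ := norm_pos_iff.2 fun h => hyK (by rw [sub_eq_zero.1 h]; exact hp)
  -- Test the farthest point of the ball in the direction `u` separating `y` from `K`: its neighbour
  -- `k` in `K` would lie beyond the supporting hyperplane at `p`.
  obtain ⟨k, hk, hbk⟩ := hnear ((μ / ‖u‖) • u) (by
    rw [norm_smul, norm_div, norm_norm, Real.norm_of_nonneg hμ, div_mul_cancel₀ _ hu0.ne'])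
  have h1 := hpi k hk
  have h2 : inner ℝ u ((μ / ‖u‖) • u - k) ≤ ‖u‖ * ε :=
    (real_inner_le_norm _ _).trans (mul_le_mul_of_nonneg_left hbk hu0.le)
  have h3 : inner ℝ u y ≤ ‖u‖ * (μ - ε) :=
    (real_inner_le_norm _ _).trans (mul_le_mul_of_nonneg_left hy hu0.le)
  have h4 : inner ℝ u y - inner ℝ u p = ‖u‖ ^ 2 := by
    rw [← inner_sub_right, ← hu, real_inner_self_eq_norm_sq]
  rw [inner_sub_right, inner_smul_right, real_inner_self_eq_norm_sq] at h2
  rw [inner_sub_right] at h1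
  have h5 : μ / ‖u‖ * ‖u‖ ^ 2 = ‖u‖ * μ := by field_simp
  nlinarith [sq_pos_of_pos hu0]

end Convexity

/-! ### Distance of almost spanning points from a subspace -/

section Residual

theorem norm_sub_orthogonalProjectionOnto_le_norm {E : Type*} [NormedAddCommGroup E]
    [InnerProductSpace ℝ E] (S : Submodule ℝ E) [S.HasOrthogonalProjection] (x : E) :
    ‖x - S.orthogonalProjectionOnto x‖ ≤ ‖x‖ := by
  have h : Sᗮ.starProjection x = x - S.orthogonalProjectionOnto x := by
    rw [S.starProjection_orthogonal_val]
    rfl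
  rw [← h]
  exact Sᗮ.norm_starProjection_apply_le x

variable {E : Type*} [NormedAddCommGroup E] [InnerProductSpace ℝ E] [FiniteDimensional ℝ E]
  {ι : Type*} [Fintype ι] {S : Submodule ℝ E} {w : ι → E} {μ ε : ℝ}

/-- The weights with residual at most `ε` form a compact convex set, so `mem_of_closedBall_near`
applies to its image in `S`. Thus exact representation of `y` and a small residual are obtained with
the same weights. -/
theorem exists_weights_of_closedBall_near (hμ : 0 ≤ μ)
    (hnear : ∀ v ∈ S, ‖v‖ ≤ μ → ∃ π ∈ stdSimplex ℝ ι, ‖v - ∑ j, π j • w j‖ ≤ ε)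
    {y : S} (hy : ‖y‖ ≤ μ - ε) :
    ∃ π ∈ stdSimplex ℝ ι, ∑ j, π j • S.orthogonalProjectionOnto (w j) = y ∧
      ‖∑ j, π j • (w j - S.orthogonalProjectionOnto (w j))‖ ≤ ε := by
  set A : (ι → ℝ) →ₗ[ℝ] S :=
    Fintype.linearCombination ℝ (fun j => S.orthogonalProjectionOnto (w j)) with hA
  set R : (ι → ℝ) →ₗ[ℝ] E :=
    Fintype.linearCombination ℝ (fun j => w j - S.orthogonalProjectionOnto (w j)) with hR
  have hAc : Continuous A := A.continuous_of_finiteDimensional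
  have hRc : Continuous R := R.continuous_of_finiteDimensional
  set Q : Set (ι → ℝ) := stdSimplex ℝ ι ∩ R ⁻¹' closedBall 0 ε with hQ
  have hQconv : Convex ℝ Q := (convex_stdSimplex ℝ ι).inter
    ((convex_closedBall 0 ε).linear_preimage R)
  have hQcomp : IsCompact Q := (isCompact_stdSimplex ℝ ι).inter_right
    (isClosed_closedBall.preimage hRc)
  have key : y ∈ A '' Q := by
    refine mem_of_closedBall_near (hQconv.linear_image A) (hQcomp.image hAc).isClosed hμ ?_ hy
    intro b hb
    obtain ⟨π, hπ, h⟩ := hnear b b.2 hb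
    have e1 : b - A π = S.orthogonalProjectionOnto ((b : E) - ∑ j, π j • w j) := by
      simp [hA, Fintype.linearCombination_apply, map_sum, map_sub]
    have e2 : -R π = ((b : E) - ∑ j, π j • w j) -
        S.orthogonalProjectionOnto ((b : E) - ∑ j, π j • w j) := by
      simp [hR, Fintype.linearCombination_apply, map_sum, map_sub, smul_sub]
    refine ⟨A π, ⟨π, ⟨hπ, ?_⟩, rfl⟩, ?_⟩
    · rw [Set.mem_preimage, mem_closedBall_zero_iff, ← norm_neg, e2]
      refine le_trans ?_ h
      exact norm_sub_orthogonalProjectionOnto_le_norm S _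
    · rw [e1]
      exact (S.norm_orthogonalProjectionOnto_apply_le _).trans h
  obtain ⟨π, ⟨hπ, hπR⟩, hπA⟩ := key
  refine ⟨π, hπ, by simpa [hA, Fintype.linearCombination_apply] using hπA, ?_⟩
  simpa [hR, Fintype.linearCombination_apply] using hπR

/-- If the convex hull of `dim S + 1` points comes within `ε` of the ball of radius `μ` of `S`,
then these points are close to `S`. -/
theorem norm_sub_orthogonalProjectionOnto_le (hcard : Fintype.card ι = Module.finrank ℝ S + 1)
    (hε : 0 ≤ ε) (hεμ : ε < μ)
    (hnear : ∀ v ∈ S, ‖v‖ ≤ μ → ∃ π ∈ stdSimplex ℝ ι, ‖v - ∑ j, π j • w j‖ ≤ ε)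
    {M : ℝ} (j : ι) (hM : ‖S.orthogonalProjectionOnto (w j)‖ ≤ M) :
    ‖w j - S.orthogonalProjectionOnto (w j)‖ ≤ ε * (2 * M / (μ - ε) + 1) := by
  classical
  set c : ι → S := fun j => S.orthogonalProjectionOnto (w j) with hc
  have hρ : 0 < μ - ε := sub_pos.2 hεμ
  have hμ : 0 ≤ μ := hε.trans hεμ.le
  have hM0 : 0 ≤ M := (norm_nonneg _).trans hM
  have hw := fun y : S => exists_weights_of_closedBall_near (y := y) hμ hnear
  -- Recording the total weight makes both dimensions equal `dim S + 1`, so surjectivity, which the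
  -- ball provides, gives injectivity: weights are determined by projected point and mass.
  set T : (ι → ℝ) →ₗ[ℝ] S × ℝ :=
    (Fintype.linearCombination ℝ c).prod (Fintype.linearCombination ℝ fun _ => (1 : ℝ)) with hT
  have hTa : ∀ π : ι → ℝ, T π = (∑ j, π j • c j, ∑ j, π j) := fun π => by
    simp [hT, Fintype.linearCombination_apply]
  obtain ⟨π₀, hπ₀, h0, hr0⟩ := hw 0 (by simpa using hρ.le)
  have hT0 : T π₀ = (0, 1) := by rw [hTa, hπ₀.2]; simp only [hc, h0]
  have hTball : ∀ y : S, ∃ s : ℝ, ∃ π ∈ stdSimplex ℝ ι, s • T π = (y, s) := fun y => by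
    obtain ⟨π, hπ, h, -⟩ := hw (((μ - ε) / (‖y‖ + 1)) • y) (by
      rw [norm_smul, norm_div, Real.norm_of_nonneg hρ.le, Real.norm_of_nonneg (by positivity),
        div_mul_eq_mul_div]
      exact div_le_of_le_mul₀ (by positivity) hρ.le (by nlinarith [norm_nonneg y]))
    refine ⟨(‖y‖ + 1) / (μ - ε), π, hπ, ?_⟩
    rw [hTa, hπ.2]
    simp only [hc, h, Prod.smul_mk, smul_smul, smul_eq_mul, mul_one]
    rw [div_mul_div_cancel₀ hρ.ne', div_self (by positivity), one_smul]
  have hsurj : Function.Surjective T := fun ⟨y, a⟩ => by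
    obtain ⟨s, π, -, h⟩ := hTball y
    refine ⟨s • π + (a - s) • π₀, ?_⟩
    rw [map_add, map_smul, map_smul, h, hT0]
    simp
  have hinj : Function.Injective T := by
    rw [LinearMap.injective_iff_surjective_of_finrank_eq_finrank (by simp [hcard])]
    exact hsurj
  -- This scale brings `s⁻¹ • c j` into the ball of radius `μ - ε`. If `s = 0` then `c j = 0`, and
  -- the convention `0⁻¹ = 0` is harmless.
  set s : ℝ := M / (μ - ε) with hs
  have hs0 : 0 ≤ s := div_nonneg hM0 hρ.le
  have hcs : s • (s⁻¹ • c j) = c j := by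
    rcases hM0.eq_or_lt with h | h
    · have : c j = 0 := norm_le_zero_iff.1 (hM.trans_eq h.symm)
      simp [this]
    · rw [smul_smul, mul_inv_cancel₀ (div_pos h hρ).ne', one_smul]
  obtain ⟨π, hπ, hπc, hπr⟩ := hw (s⁻¹ • c j) (by
    rw [norm_smul, norm_inv, Real.norm_of_nonneg hs0, hs, inv_div, div_mul_eq_mul_div]
    exact div_le_of_le_mul₀ hM0 hρ.le (mul_le_mul_of_nonneg_left hM hρ.le))
  -- By injectivity the vertex weight is an affine combination of two weights of residual at most
  -- `ε`; hence the factor `s + (1 + s)` below.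
  have hsingle : s • π + (1 - s) • π₀ = Pi.single j 1 := by
    apply hinj
    have e1 : T π = (s⁻¹ • c j, 1) := by rw [hTa, hπ.2]; simp only [hc, hπc]
    have e2 : T (Pi.single j 1) = (c j, 1) := by
      simp [hT, Fintype.linearCombination_apply_single]
    rw [map_add, map_smul, map_smul, e1, e2, hT0, Prod.smul_mk, hcs]
    simp
  have hres : w j - c j = s • ∑ i, π i • (w i - c i) + (1 - s) • ∑ i, π₀ i • (w i - c i) := by
    have := congrArg (Fintype.linearCombination ℝ fun i => w i - (c i : E)) hsingle
    rw [map_add, map_smul, map_smul, Fintype.linearCombination_apply_single, one_smul] at this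
    exact this.symm
  change ‖w j - c j‖ ≤ _
  rw [hres]
  refine (norm_add_le _ _).trans ?_
  rw [norm_smul, norm_smul, Real.norm_of_nonneg hs0, mul_div_assoc, ← hs]
  have h1 : ‖1 - s‖ ≤ 1 + s := by
    rw [Real.norm_eq_abs, abs_le]; constructor <;> linarith
  have h2 := mul_le_mul_of_nonneg_left hπr hs0
  have h3 := mul_le_mul h1 hr0 (norm_nonneg _) (by linarith)
  linarith

end Residual

/-! ### Extreme singular values as bounds on the range -/

section SingularValues

variable {E F : Type*} [NormedAddCommGroup E] [InnerProductSpace ℝ E] [FiniteDimensional ℝ E]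
  [NormedAddCommGroup F] [InnerProductSpace ℝ F] [FiniteDimensional ℝ F] (T : E →ₗ[ℝ] F)

theorem norm_sq_apply_eq_sum_eigenvalues (x : E) :
    ‖T x‖ ^ 2 = ∑ i, T.isSymmetric_adjoint_comp_self.eigenvalues rfl i *
      (T.isSymmetric_adjoint_comp_self.eigenvectorBasis rfl).repr x i ^ 2 := by
  rw [← real_inner_self_eq_norm_sq, ← LinearMap.adjoint_inner_left, ← LinearMap.comp_apply,
    ← (T.isSymmetric_adjoint_comp_self.eigenvectorBasis rfl).repr.inner_map_map]
  simp only [PiLp.inner_apply, T.isSymmetric_adjoint_comp_self.eigenvectorBasis_apply_self_apply]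
  refine Finset.sum_congr rfl fun i _ => ?_
  simp
  ring

theorem norm_sq_adjoint_apply_eq_sum_eigenvalues (x : E) :
    ‖T.adjoint (T x)‖ ^ 2 = ∑ i, T.isSymmetric_adjoint_comp_self.eigenvalues rfl i ^ 2 *
      (T.isSymmetric_adjoint_comp_self.eigenvectorBasis rfl).repr x i ^ 2 := by
  rw [← LinearMap.comp_apply,
    ← (T.isSymmetric_adjoint_comp_self.eigenvectorBasis rfl).repr.norm_map,
    EuclideanSpace.norm_sq_eq]
  refine Finset.sum_congr rfl fun i _ => ?_
  rw [T.isSymmetric_adjoint_comp_self.eigenvectorBasis_apply_self_apply]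
  simp [mul_pow]

theorem norm_adjoint_apply_le (x : E) : ‖T.adjoint (T x)‖ ≤ T.singularValues 0 * ‖T x‖ := by
  refine le_of_sq_le_sq ?_ (mul_nonneg (T.singularValues_nonneg 0) (norm_nonneg _))
  rw [mul_pow, norm_sq_adjoint_apply_eq_sum_eigenvalues, norm_sq_apply_eq_sum_eigenvalues,
    Finset.mul_sum]
  refine Finset.sum_le_sum fun i _ => ?_
  rw [sq (T.isSymmetric_adjoint_comp_self.eigenvalues rfl i), mul_assoc]
  refine mul_le_mul_of_nonneg_right ?_ (mul_nonneg
    (T.isPositive_adjoint_comp_self.nonneg_eigenvalues rfl i) (sq_nonneg _))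
  rw [← T.sq_singularValues_fin rfl i]
  exact pow_le_pow_left₀ (T.singularValues_nonneg _) (T.singularValues_antitone (Nat.zero_le _)) 2

/-- In an eigenbasis of `T* T`, the squared norms of `T x` and `T* T x` weight the squared
coordinates by the eigenvalues and by their squares. Zero eigenvalues contribute to neither, so the
smallest nonzero one suffices. -/
theorem le_norm_adjoint_apply (x : E) :
    T.singularValues (Module.finrank ℝ T.range - 1) * ‖T x‖ ≤ ‖T.adjoint (T x)‖ := by
  refine le_of_sq_le_sq ?_ (norm_nonneg _)
  rw [mul_pow, norm_sq_adjoint_apply_eq_sum_eigenvalues, norm_sq_apply_eq_sum_eigenvalues,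
    Finset.mul_sum]
  refine Finset.sum_le_sum fun i _ => ?_
  rw [sq (T.isSymmetric_adjoint_comp_self.eigenvalues rfl i), mul_assoc]
  rcases lt_or_ge (i : ℕ) (Module.finrank ℝ T.range) with h | h
  · refine mul_le_mul_of_nonneg_right ?_ (mul_nonneg
      (T.isPositive_adjoint_comp_self.nonneg_eigenvalues rfl i) (sq_nonneg _))
    rw [← T.sq_singularValues_fin rfl i]
    exact pow_le_pow_left₀ (T.singularValues_nonneg _)
      (T.singularValues_antitone (Nat.le_sub_one_of_lt h)) 2
  · rw [← T.sq_singularValues_fin rfl i, T.singularValues_eq_zero_iff_le_finrank_range.2 h]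
    simp

end SingularValues

/-! ### Matching the vertices of nearby simplices -/

section Matching

variable {ι : Type*} [Fintype ι] [DecidableEq ι]

/-- The coordinates other than `l` are nonnegative with sum `1 - G l`, so their squares sum to at
most `(1 - G l) ^ 2`. -/
theorem sum_single_sub_sq_le {G : ι → ℝ} (hG : G ∈ stdSimplex ℝ ι) (l : ι) :
    ∑ k, ((Pi.single l 1 : ι → ℝ) k - G k) ^ 2 ≤ 2 * (1 - G l) ^ 2 := by
  have h1 : ∑ k ∈ Finset.univ.erase l, G k = 1 - G l := by
    rw [← hG.2, ← Finset.add_sum_erase _ _ (Finset.mem_univ l)]; ring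
  have h2 : ∑ k ∈ Finset.univ.erase l, ((Pi.single l 1 : ι → ℝ) k - G k) ^ 2 =
      ∑ k ∈ Finset.univ.erase l, G k ^ 2 := Finset.sum_congr rfl fun k hk => by
    rw [Pi.single_eq_of_ne (Finset.ne_of_mem_erase hk)]; ring
  have h3 := Finset.sum_sq_le_sq_sum_of_nonneg (s := Finset.univ.erase l) (f := G) fun k _ => hG.1 k
  rw [← Finset.add_sum_erase _ _ (Finset.mem_univ l), h2, Pi.single_eq_same]
  rw [h1] at h3
  linarith

variable {E : Type*} [NormedAddCommGroup E] [NormedSpace ℝ E] {h₀ h : ι → E} {σ τ : ℝ}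

theorem norm_sub_sum_smul_le (hτ : 0 ≤ τ)
    (hup : ∀ w : ι → ℝ, ‖∑ k, w k • h₀ k‖ ≤ τ * √(∑ k, w k ^ 2))
    {G : ι → ℝ} (hG : G ∈ stdSimplex ℝ ι) (l : ι) :
    ‖h₀ l - ∑ k, G k • h₀ k‖ ≤ τ * (√2 * (1 - G l)) := by
  have h1 := hup (Pi.single l 1 - G)
  have h2 : ∑ k, (Pi.single l 1 - G : ι → ℝ) k • h₀ k = h₀ l - ∑ k, G k • h₀ k := by
    simp [sub_smul, Finset.sum_sub_distrib, Pi.single_apply, ite_smul]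
  rw [h2] at h1
  refine h1.trans (mul_le_mul_of_nonneg_left ?_ hτ)
  have hG1 : 0 ≤ 1 - G l := sub_nonneg.2 (mem_Icc_of_mem_stdSimplex hG l).2
  rw [← Real.sqrt_sq hG1, ← Real.sqrt_mul zero_le_two]
  exact Real.sqrt_le_sqrt (sum_single_sub_sq_le hG l)

theorem norm_sub_le_of_linear_bound (hτ : 0 ≤ τ)
    (hup : ∀ w : ι → ℝ, ‖∑ k, w k • h₀ k‖ ≤ τ * √(∑ k, w k ^ 2)) (l l' : ι) :
    ‖h₀ l - h₀ l'‖ ≤ √2 * τ := by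
  have h1 := norm_sub_sum_smul_le hτ hup (single_mem_stdSimplex ℝ l') l
  have h2 : ∑ k, (Pi.single l' 1 : ι → ℝ) k • h₀ k = h₀ l' := by
    simp [Pi.single_apply, ite_smul]
  rw [h2] at h1
  have h3 := (single_mem_stdSimplex ℝ l').1 l
  have : τ * (√2 * (1 - (Pi.single l' 1 : ι → ℝ) l)) ≤ τ * (√2 * 1) :=
    mul_le_mul_of_nonneg_left (mul_le_mul_of_nonneg_left (by linarith) (Real.sqrt_nonneg 2)) hτ
  linarith

/-- If two simplices are close to each other, each vertex of a well conditioned one is close to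
some vertex of the other one. -/
theorem exists_vertex_near [Nonempty ι] (hτ : 0 ≤ τ) (hσ : 0 < σ)
    (hup : ∀ w : ι → ℝ, ‖∑ k, w k • h₀ k‖ ≤ τ * √(∑ k, w k ^ 2))
    (hlow : ∀ w : ι → ℝ, σ * √(∑ k, w k ^ 2) ≤ ‖∑ k, w k • h₀ k‖) {a b : ℝ}
    (ha : ∀ j, infDist (h j) (convexHull ℝ (Set.range h₀)) ≤ a)
    (l : ι) (hb : infDist (h₀ l) (convexHull ℝ (Set.range h)) ≤ b) :
    ∃ j, ‖h₀ l - h j‖ ≤ a + √2 * (τ / σ) * (a + b) := by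
  have hG : ∀ j, ∃ G ∈ stdSimplex ℝ ι, ‖h j - ∑ k, G k • h₀ k‖ ≤ a := fun j => by
    obtain ⟨y, hy, hd⟩ := exists_mem_convexHull_range_norm_sub h₀ (h j)
    obtain ⟨G, hG, rfl⟩ := mem_convexHull_range_iff.1 hy
    exact ⟨G, hG, hd ▸ ha j⟩
  choose G hG hGa using hG
  obtain ⟨y, hy, hd⟩ := exists_mem_convexHull_range_norm_sub h (h₀ l)
  obtain ⟨π, hπ, rfl⟩ := mem_convexHull_range_iff.1 hy
  rw [hd] at hb
  obtain ⟨j, hj⟩ := Finite.exists_max fun j => G j l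
  -- Error of the barycentric coordinates when `h₀ l` is replaced by a mixture of points near the `h
  -- i`. An average of `G i l` is at most its maximum `G j l`, so a small `w l` forces `G j l` near
  -- `1`.
  set w : ι → ℝ := fun k => (Pi.single l 1 : ι → ℝ) k - ∑ i, π i * G i k with hw
  have hwl : 1 - G j l ≤ w l := by
    have : ∑ i, π i * G i l ≤ ∑ i, π i * G j l :=
      Finset.sum_le_sum fun i _ => mul_le_mul_of_nonneg_left (hj i) (hπ.1 i)
    rw [← Finset.sum_mul, hπ.2, one_mul] at this
    simp only [hw, Pi.single_eq_same]
    linarith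
  have hwe : ∑ k, w k • h₀ k = (h₀ l - ∑ i, π i • h i) +
      ∑ i, π i • (h i - ∑ k, G i k • h₀ k) := by
    have e1 : ∑ k, (∑ i, π i * G i k) • h₀ k = ∑ i, π i • ∑ k, G i k • h₀ k := by
      simp_rw [Finset.sum_smul, Finset.smul_sum, smul_smul]
      exact Finset.sum_comm
    simp only [hw, sub_smul, Finset.sum_sub_distrib, smul_sub, e1]
    simp [Pi.single_apply, ite_smul]
  have hwn : ‖∑ k, w k • h₀ k‖ ≤ a + b := by
    rw [hwe, add_comm a b]
    exact (norm_add_le _ _).trans (add_le_add hb (norm_sum_smul_le hπ hGa))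
  have h1 : 1 - G j l ≤ (a + b) / σ := by
    rw [le_div_iff₀ hσ, mul_comm]
    exact (mul_le_mul_of_nonneg_left (hwl.trans (le_sqrt_sum_sq w l)) hσ.le).trans
      ((hlow w).trans hwn)
  refine ⟨j, ?_⟩
  have h2 := norm_sub_sum_smul_le hτ hup (hG j) l
  have h3 : τ * (√2 * (1 - G j l)) ≤ τ * (√2 * ((a + b) / σ)) :=
    mul_le_mul_of_nonneg_left (mul_le_mul_of_nonneg_left h1 (Real.sqrt_nonneg 2)) hτ
  have h4 : τ * (√2 * ((a + b) / σ)) = √2 * (τ / σ) * (a + b) := by ring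
  have h5 := norm_sub_le_norm_sub_add_norm_sub (h₀ l) (∑ k, G j k • h₀ k) (h j)
  have h6 := hGa j
  rw [norm_sub_rev] at h6
  linarith

end Matching

/-! ### Geometry of a simplex around a ball -/

section

/-- The Euclidean norm of the vector of distances from the points `h l` to the set `K`. -/
noncomputable def l2InfDist {ι E : Type*} [Fintype ι] [PseudoMetricSpace E] (h : ι → E)
    (K : Set E) : ℝ := √(∑ l, infDist (h l) K ^ 2)

section Distances

variable {ι E : Type*} [Fintype ι] [NormedAddCommGroup E]

theorem infDist_le_l2InfDist (h : ι → E) (K : Set E) (l : ι) : infDist (h l) K ≤ l2InfDist h K :=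
  le_sqrt_sum_sq (fun l => infDist (h l) K) l

theorem l2InfDist_nonneg (h : ι → E) (K : Set E) : 0 ≤ l2InfDist h K := Real.sqrt_nonneg _

theorem l2InfDist_le {h h' : ι → E} {K K' : Set E} {s c : ℝ} (hs : 0 ≤ s) (hc : 0 ≤ c)
    (hle : ∀ l, infDist (h l) K ≤ s * infDist (h' l) K' + c) :
    l2InfDist h K ≤ s * l2InfDist h' K' + √(Fintype.card ι) * c :=
  sqrt_sum_sq_le hs hc (fun _ => infDist_nonneg) hle

theorem l2InfDist_le_of_le {h : ι → E} {K : Set E} {c : ℝ} (hc : 0 ≤ c)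
    (hle : ∀ l, infDist (h l) K ≤ c) : l2InfDist h K ≤ √(Fintype.card ι) * c := by
  have := l2InfDist_le (h' := h) (K' := K) le_rfl hc fun l => by simpa using hle l
  simpa using this

end Distances

variable {E : Type*} [NormedAddCommGroup E] [InnerProductSpace ℝ E] {ι : Type*} [Fintype ι]

theorem sum_smul_sub_const {π : ι → ℝ} (hπ : π ∈ stdSimplex ℝ ι) (h : ι → E) (z : E) :
    ∑ j, π j • (h j - z) = ∑ j, π j • h j - z := by
  simp only [smul_sub, Finset.sum_sub_distrib]
  rw [← Finset.sum_smul, hπ.2, one_smul]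

theorem sum_smul_const_add {π : ι → ℝ} (hπ : π ∈ stdSimplex ℝ ι) (h : ι → E) (z : E) :
    ∑ j, π j • (z + h j) = z + ∑ j, π j • h j := by
  simp only [smul_add, Finset.sum_add_distrib]
  rw [← Finset.sum_smul, hπ.2, one_smul]

theorem two_mul_radius_le {J : Type*} {S : Submodule ℝ E} (hS : S ≠ ⊥) {h₀ : J → E} {z₀ : E}
    {μ D : ℝ}
    (hμ : 0 < μ) (hball : ∀ v ∈ S, ‖v‖ ≤ μ → z₀ + v ∈ convexHull ℝ (Set.range h₀))
    (hD : ∀ l l', ‖h₀ l - h₀ l'‖ ≤ D) : 2 * μ ≤ D := by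
  obtain ⟨v, hv, hv0⟩ := S.ne_bot_iff.1 hS
  have hv0 : 0 < ‖v‖ := norm_pos_iff.2 hv0
  have hn : ‖(μ / ‖v‖) • v‖ = μ := by
    rw [norm_smul, norm_div, norm_norm, Real.norm_of_nonneg hμ.le, div_mul_cancel₀ _ hv0.ne']
  have h1 := hball _ (S.smul_mem (μ / ‖v‖) hv) hn.le
  have h2 := hball _ (S.neg_mem (S.smul_mem (μ / ‖v‖) hv)) (by rw [norm_neg, hn])
  have h3 := norm_sub_le_of_mem_convexHull (D := D) (by
    rintro _ ⟨l, rfl⟩ _ ⟨l', rfl⟩; exact hD l l') h1 h2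
  rwa [add_sub_add_left_eq_sub, sub_neg_eq_add, ← two_smul ℝ ((μ / ‖v‖) • v), norm_smul, hn,
    Real.norm_of_nonneg zero_le_two] at h3

/-- Under a large dilation about `z₀` the distances to `C` and to the true simplex both blow up but
differ by a bounded amount, so uniqueness fails if `α > 1`. -/
theorem alpha_le_one [Nonempty ι] {C : Set E} {h₀ : ι → E} {z₀ : E} {α D : ℝ}
    (hC : C ⊆ convexHull ℝ (Set.range h₀)) (hz₀ : z₀ ∈ C) (hD : ∀ l l', ‖h₀ l - h₀ l'‖ ≤ D)
    (hne : ∃ l, h₀ l ≠ z₀)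
    (huniq : ∀ h : ι → E, C ⊆ convexHull ℝ (Set.range h) →
      l2InfDist h₀ C + α * (l2InfDist h (convexHull ℝ (Set.range h₀)) +
        l2InfDist h₀ (convexHull ℝ (Set.range h))) ≤ l2InfDist h C) : α ≤ 1 := by
  by_contra! hα
  obtain ⟨l, hl⟩ := hne
  have hl0 : 0 < ‖h₀ l - z₀‖ := norm_pos_iff.2 (sub_ne_zero.2 hl)
  have hD0 : 0 ≤ D := (norm_nonneg _).trans (hD l l)
  have hdiam : ∀ x ∈ convexHull ℝ (Set.range h₀), ∀ y ∈ convexHull ℝ (Set.range h₀),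
      ‖x - y‖ ≤ D := fun x hx y hy => norm_sub_le_of_mem_convexHull (by
    rintro _ ⟨l, rfl⟩ _ ⟨l', rfl⟩; exact hD l l') hx hy
  set B : ℝ := √(Fintype.card ι) * D / (α - 1) with hB
  have hα' : 0 < α - 1 := sub_pos.2 hα
  have hB0 : 0 ≤ B := by positivity
  -- Chosen to put `h l` at distance at least `B + 1` from the true simplex, past the threshold `B`
  -- at which `α > 1` becomes contradictory.
  set s : ℝ := 1 + (D + B + 1) / ‖h₀ l - z₀‖ with hs
  have hs1 : 1 ≤ s := le_add_of_nonneg_right (by positivity)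
  set h : ι → E := fun j => z₀ + s • (h₀ j - z₀) with hh
  have hsum : ∀ π ∈ stdSimplex ℝ ι, ∑ j, π j • h j = z₀ + s • (∑ j, π j • h₀ j - z₀) :=
    fun π hπ => by
      rw [hh, sum_smul_const_add hπ, ← sum_smul_sub_const hπ, Finset.smul_sum]
      simp only [smul_comm s]
  have hz : z₀ ∈ convexHull ℝ (Set.range h) := by
    obtain ⟨π, hπ, h1⟩ := mem_convexHull_range_iff.1 (hC hz₀)
    exact mem_convexHull_range_iff.2 ⟨π, hπ, by rw [hsum π hπ, h1]; simp⟩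
  have hsub : C ⊆ convexHull ℝ (Set.range h) := fun x hx => by
    obtain ⟨π, hπ, h1⟩ := mem_convexHull_range_iff.1 (hC hx)
    have h2 := sum_smul_mem_convexHull_range h hπ
    rw [hsum π hπ, h1] at h2
    have h3 := (convex_convexHull ℝ (Set.range h)).add_smul_sub_mem hz h2 (t := s⁻¹)
      ⟨by positivity, inv_le_one_of_one_le₀ hs1⟩
    rwa [add_sub_cancel_left, smul_smul, inv_mul_cancel₀ (by positivity), one_smul,
      add_sub_cancel] at h3
  have h1 := huniq h hsub
  have h2 : l2InfDist h C ≤ 1 * l2InfDist h (convexHull ℝ (Set.range h₀)) +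
      √(Fintype.card ι) * D := l2InfDist_le zero_le_one hD0 fun j => by
    obtain ⟨y, hy, hd⟩ := exists_mem_convexHull_range_norm_sub h₀ (h j)
    rw [hd, one_mul]
    have h3 := infDist_le_norm_sub (x := h j) hz₀
    have h4 := norm_sub_le_norm_sub_add_norm_sub (h j) y z₀
    have h5 := hdiam y hy z₀ (hC hz₀)
    linarith
  have h3 : B + 1 ≤ l2InfDist h (convexHull ℝ (Set.range h₀)) := by
    refine le_trans ?_ (infDist_le_l2InfDist h _ l)
    obtain ⟨y, hy, hd⟩ := exists_mem_convexHull_range_norm_sub h₀ (h l)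
    rw [hd]
    have h4 := norm_sub_le_norm_sub_add_norm_sub (h l) y z₀
    have h5 := hdiam y hy z₀ (hC hz₀)
    have h6 : ‖h l - z₀‖ = ‖h₀ l - z₀‖ + (D + B + 1) := by
      rw [hh, add_sub_cancel_left, norm_smul, Real.norm_of_nonneg (by positivity), hs, add_mul,
        one_mul, div_mul_cancel₀ _ hl0.ne']
    linarith
  have h4 := l2InfDist_nonneg h₀ C
  have h5 := mul_nonneg (zero_le_one.trans hα.le)
    (l2InfDist_nonneg h₀ (convexHull ℝ (Set.range h)))
  have h6 : (α - 1) * B = √(Fintype.card ι) * D := mul_div_cancel₀ _ hα'.ne'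
  nlinarith

variable [FiniteDimensional ℝ E] {S : Submodule ℝ E}

/-- The case `ε = 0` of `norm_sub_orthogonalProjectionOnto_le`: a simplex with `dim S + 1` vertices
containing a ball of `z₀ + S` lies in `z₀ + S`. -/
theorem sub_mem_of_closedBall_subset
    (hcard : Fintype.card ι = Module.finrank ℝ S + 1) {h₀ : ι → E} {z₀ : E} {μ : ℝ} (hμ : 0 < μ)
    (hball : ∀ v ∈ S, ‖v‖ ≤ μ → z₀ + v ∈ convexHull ℝ (Set.range h₀)) {x : E}
    (hx : x ∈ convexHull ℝ (Set.range h₀)) : x - z₀ ∈ S := by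
  have h1 : ∀ j, h₀ j - z₀ ∈ S := fun j => by
    have := norm_sub_orthogonalProjectionOnto_le (w := fun j => h₀ j - z₀) hcard le_rfl hμ
      (fun v hv hvμ => by
        obtain ⟨π, hπ, h⟩ := mem_convexHull_range_iff.1 (hball v hv hvμ)
        refine ⟨π, hπ, ?_⟩
        rw [sum_smul_sub_const hπ, h]
        simp) j le_rfl
    rw [zero_mul] at this
    rw [sub_eq_zero.1 (norm_le_zero_iff.1 this)]
    exact Submodule.coe_mem _
  obtain ⟨π, hπ, rfl⟩ := mem_convexHull_range_iff.1 hx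
  rw [← sum_smul_sub_const hπ]
  exact S.sum_mem fun j _ => S.smul_mem _ (h1 j)

/-- After projection, `x - z₀` is a mixture of the projected points plus an error `v` of norm at
most `ε`. Since `t⁻¹ • v` lies in the ball of radius `μ - ε`, it is a second mixture, and the two
have total mass `1 + t`, which the dilation absorbs. -/
theorem mem_convexHull_dilation {h : ι → E} {z₀ : E} {μ ε : ℝ} (hε : 0 ≤ ε) (hεμ : ε < μ)
    (hnear : ∀ v ∈ S, ‖v‖ ≤ μ → ∃ π ∈ stdSimplex ℝ ι, ‖v - ∑ j, π j • (h j - z₀)‖ ≤ ε) {x : E}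
    (hxS : x - z₀ ∈ S) (hx : ∃ π ∈ stdSimplex ℝ ι, ‖x - ∑ j, π j • h j‖ ≤ ε) :
    x ∈ convexHull ℝ (Set.range fun j =>
      z₀ + (1 + ε / (μ - ε)) • (S.orthogonalProjectionOnto (h j - z₀) : E)) := by
  have hρ : 0 < μ - ε := sub_pos.2 hεμ
  set t : ℝ := ε / (μ - ε) with ht
  have ht0 : 0 ≤ t := div_nonneg hε hρ.le
  obtain ⟨π, hπ, hxπ⟩ := hx
  set v : S := S.orthogonalProjectionOnto (x - ∑ j, π j • h j) with hv
  have hvε : ‖v‖ ≤ ε := (S.norm_orthogonalProjectionOnto_apply_le _).trans hxπ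
  have hvt : t • (t⁻¹ • v) = v := by
    rcases hε.eq_or_lt with h | h
    · have : v = 0 := norm_le_zero_iff.1 (hvε.trans_eq h.symm)
      simp [this]
    · rw [smul_smul, mul_inv_cancel₀ (div_pos h hρ).ne', one_smul]
  obtain ⟨π', hπ', hy, -⟩ := exists_weights_of_closedBall_near (hε.trans hεμ.le) hnear
    (y := t⁻¹ • v) (by
      rw [norm_smul, norm_inv, Real.norm_of_nonneg ht0, ht, inv_div, div_mul_eq_mul_div]
      exact div_le_of_le_mul₀ hε hρ.le (mul_le_mul_of_nonneg_left hvε hρ.le))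
  have hxv : ((S.orthogonalProjectionOnto (x - z₀) : S) : E) = x - z₀ :=
    congrArg Subtype.val (S.orthogonalProjectionOnto_mem_subspace_eq_self ⟨x - z₀, hxS⟩)
  have hπsum : ∑ j, π j • S.orthogonalProjectionOnto (h j - z₀) =
      S.orthogonalProjectionOnto (x - z₀) - v := by
    rw [hv, ← map_sub, sub_sub_sub_cancel_left, ← sum_smul_sub_const hπ, map_sum]
    simp only [map_smul]
  have hmem := (convex_stdSimplex ℝ ι) hπ hπ' (a := (1 + t)⁻¹) (b := (1 + t)⁻¹ * t)
    (by positivity) (by positivity) (by field_simp)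
  refine mem_convexHull_range_iff.2 ⟨_, hmem, ?_⟩
  rw [sum_smul_const_add hmem]
  have hS : ∑ j, ((1 + t)⁻¹ • π + ((1 + t)⁻¹ * t) • π') j • (1 + t) •
      S.orthogonalProjectionOnto (h j - z₀) = S.orthogonalProjectionOnto (x - z₀) := by
    have e : ∀ j, ((1 + t)⁻¹ • π + ((1 + t)⁻¹ * t) • π') j • (1 + t) •
        S.orthogonalProjectionOnto (h j - z₀) = π j • S.orthogonalProjectionOnto (h j - z₀) +
          t • π' j • S.orthogonalProjectionOnto (h j - z₀) := fun j => by
      rw [smul_smul, smul_smul, ← add_smul]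
      congr 1
      simp only [Pi.add_apply, Pi.smul_apply, smul_eq_mul]
      field_simp
    simp only [e]
    rw [Finset.sum_add_distrib, ← Finset.smul_sum, hπsum, hy, hvt, sub_add_cancel]
  have hS' := congrArg Subtype.val hS
  rw [hxv] at hS'
  push_cast at hS'
  rw [hS', add_sub_cancel]

end

/-! ### From the estimator to the archetypes -/

section

variable {E : Type*} [NormedAddCommGroup E] [InnerProductSpace ℝ E] {ι : Type*} [Fintype ι]
  [FiniteDimensional ℝ E] {S : Submodule ℝ E}

/-- With `p` the point of `C` nearest to `h`, the new point minus `p` is `(1 + t)` times the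
projection of `h - p` plus `t • (p - z₀)`. -/
theorem infDist_dilation_le {C : Set E} (hCc : IsCompact C) {z₀ : E} (hz₀ : z₀ ∈ C) {D : ℝ}
    (hdiam : ∀ x ∈ C, ‖x - z₀‖ ≤ D) (hCS : ∀ x ∈ C, x - z₀ ∈ S) {t : ℝ} (ht : 0 ≤ t) (h : E) :
    infDist (z₀ + (1 + t) • (S.orthogonalProjectionOnto (h - z₀) : E)) C ≤
      (1 + t) * infDist h C + t * D := by
  obtain ⟨p, hp, hd⟩ := hCc.exists_infDist_eq_dist ⟨z₀, hz₀⟩ h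
  rw [dist_eq_norm] at hd
  have hpP : ((S.orthogonalProjectionOnto (p - z₀) : S) : E) = p - z₀ :=
    congrArg Subtype.val (S.orthogonalProjectionOnto_mem_subspace_eq_self ⟨p - z₀, hCS p hp⟩)
  have e : z₀ + (1 + t) • (S.orthogonalProjectionOnto (h - z₀) : E) - p =
      (1 + t) • ((S.orthogonalProjectionOnto (h - p) : S) : E) + t • (p - z₀) := by
    have : h - p = (h - z₀) - (p - z₀) := by abel
    rw [this, map_sub _ (h - z₀) (p - z₀), AddSubgroupClass.coe_sub, hpP]
    module
  refine (infDist_le_norm_sub hp).trans ?_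
  rw [e, hd]
  refine (norm_add_le _ _).trans (add_le_add ?_ ?_)
  · rw [norm_smul, Real.norm_of_nonneg (by positivity)]
    exact mul_le_mul_of_nonneg_left (S.norm_orthogonalProjectionOnto_apply_le _) (by positivity)
  · rw [norm_smul, Real.norm_of_nonneg ht]
    exact mul_le_mul_of_nonneg_left (hdiam p hp) ht

/-- The estimated simplex is close to one which contains `C` and is close to the true simplex. -/
theorem exists_near_simplex [Nonempty ι]
    (hcard : Fintype.card ι = Module.finrank ℝ S + 1) (hcard2 : 2 ≤ Fintype.card ι)
    {C : Set E} (hCc : IsCompact C) {h₀ hhat : ι → E} {z₀ : E} {α μ δ D : ℝ}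
    (hα : 0 < α) (hμ : 0 < μ) (hδ : 0 ≤ δ)
    (hC : C ⊆ convexHull ℝ (Set.range h₀))
    (hball : ∀ v ∈ S, ‖v‖ ≤ μ → z₀ + v ∈ C)
    (hD : ∀ l l', ‖h₀ l - h₀ l'‖ ≤ D)
    (huniq : ∀ h : ι → E, C ⊆ convexHull ℝ (Set.range h) →
      l2InfDist h₀ C + α * (l2InfDist h (convexHull ℝ (Set.range h₀)) +
        l2InfDist h₀ (convexHull ℝ (Set.range h))) ≤ l2InfDist h C)
    (hnear : ∀ x ∈ C, ∃ π ∈ stdSimplex ℝ ι, ‖x - ∑ j, π j • hhat j‖ ≤ 2 * δ)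
    (hest : l2InfDist hhat C ≤ l2InfDist h₀ C + √(Fintype.card ι) * (2 * δ))
    (hsmall : δ * (30 * (Fintype.card ι * √(Fintype.card ι))) ≤ α * μ) :
    α ≤ 1 ∧ ∃ h' : ι → E,
      l2InfDist h' (convexHull ℝ (Set.range h₀)) + l2InfDist h₀ (convexHull ℝ (Set.range h')) ≤
        6 * √(Fintype.card ι) * (δ / μ) * D / α ∧
      ∀ j, ‖h' j - hhat j‖ ≤ 8 * (δ / μ) * D := by
  set R : ℝ := √(Fintype.card ι) with hR
  have hcard2' : (2 : ℝ) ≤ Fintype.card ι := by exact_mod_cast hcard2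
  have hR1 : 1 ≤ R := Real.one_le_sqrt.2 (by linarith)
  have hz₀ : z₀ ∈ C := by simpa using hball 0 S.zero_mem (by simpa using hμ.le)
  have hS : S ≠ ⊥ := by
    rintro rfl
    rw [finrank_bot] at hcard
    omega
  have hball₀ : ∀ v ∈ S, ‖v‖ ≤ μ → z₀ + v ∈ convexHull ℝ (Set.range h₀) :=
    fun v hv hvμ => hC (hball v hv hvμ)
  have hDμ : 2 * μ ≤ D := two_mul_radius_le hS hμ hball₀ hD
  have hdiam : ∀ x ∈ convexHull ℝ (Set.range h₀), ‖x - z₀‖ ≤ D := fun x hx =>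
    norm_sub_le_of_mem_convexHull (by rintro _ ⟨l, rfl⟩ _ ⟨l', rfl⟩; exact hD l l') hx (hC hz₀)
  have hα1 : α ≤ 1 := by
    refine alpha_le_one hC hz₀ hD ?_ huniq
    by_contra! hne
    have := two_mul_radius_le (D := 0) hS hμ hball₀ fun l l' => by simp [hne]
    linarith
  have hCS : ∀ x ∈ C, x - z₀ ∈ S := fun x hx =>
    sub_mem_of_closedBall_subset hcard hμ hball₀ (hC hx)
  have hnear' : ∀ v ∈ S, ‖v‖ ≤ μ →
      ∃ π ∈ stdSimplex ℝ ι, ‖v - ∑ j, π j • (hhat j - z₀)‖ ≤ 2 * δ := fun v hv hvμ => by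
    obtain ⟨π, hπ, h⟩ := hnear _ (hball v hv hvμ)
    refine ⟨π, hπ, ?_⟩
    rwa [sum_smul_sub_const hπ, sub_sub_eq_add_sub, add_comm]
  set q : ℝ := δ / μ with hq
  have hq0 : 0 ≤ q := div_nonneg hδ hμ.le
  have hδq : δ = q * μ := (div_mul_cancel₀ _ hμ.ne').symm
  have hqα : q * (30 * (Fintype.card ι * R)) ≤ α := by
    rw [hδq] at hsmall
    nlinarith
  have hq60 : 60 * q ≤ α := by nlinarith [mul_le_mul hcard2' hR1 zero_le_one (by linarith)]
  have hD0 : 0 < D := by linarith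
  have hδD : 2 * δ ≤ q * D := by nlinarith
  have hεμ : 2 * δ < μ := by nlinarith
  set t : ℝ := 2 * δ / (μ - 2 * δ) with ht
  have ht0 : 0 ≤ t := div_nonneg (by linarith) (by linarith)
  -- Here `t = 2q / (1 - 2q)` and `q ≤ α / 60 ≤ 1 / 60`; this is where `α ≤ 1` enters.
  have htq : t ≤ 2.07 * q := by
    rw [ht, div_le_iff₀ (by linarith), hδq]
    nlinarith [mul_nonneg hq0 hμ.le, mul_le_mul_of_nonneg_right hq60 (mul_nonneg hq0 hμ.le),
      mul_le_mul_of_nonneg_right hα1 (mul_nonneg hq0 hμ.le)]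
  set c : ι → S := fun j => S.orthogonalProjectionOnto (hhat j - z₀) with hc
  set h' : ι → E := fun j => z₀ + (1 + t) • (c j : E) with hh'
  have hsub : C ⊆ convexHull ℝ (Set.range h') := fun x hx =>
    mem_convexHull_dilation (by linarith) hεμ hnear' (hCS x hx) (hnear x hx)
  have hu := huniq h' hsub
  set a := l2InfDist h' (convexHull ℝ (Set.range h₀)) with ha
  set b := l2InfDist h₀ (convexHull ℝ (Set.range h')) with hb
  have h'C : l2InfDist h' C ≤ (1 + t) * l2InfDist hhat C + R * (t * D) :=
    l2InfDist_le (by linarith) (mul_nonneg ht0 hD0.le) fun j =>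
      infDist_dilation_le hCc hz₀ (fun x hx => hdiam x (hC hx)) hCS ht0 (hhat j)
  have h₀C : l2InfDist h₀ C ≤ R * D := l2InfDist_le_of_le hD0.le fun j =>
    (infDist_le_norm_sub hz₀).trans (hdiam _ (subset_convexHull ℝ _ ⟨j, rfl⟩))
  have hαab : α * (a + b) ≤ 6 * R * q * D := by
    have h1 : (1 + t) * l2InfDist hhat C ≤ (1 + t) * (l2InfDist h₀ C + R * (2 * δ)) :=
      mul_le_mul_of_nonneg_left hest (by linarith)
    have h2 : t * l2InfDist h₀ C ≤ t * (R * D) := mul_le_mul_of_nonneg_left h₀C ht0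
    have h3 : (1 + t) * (2 * δ) ≤ 1.1 * (q * D) :=
      mul_le_mul (by linarith) hδD (by linarith) (by norm_num)
    have h4 : t * D ≤ 2.07 * q * D := mul_le_mul_of_nonneg_right htq hD0.le
    have h5 : R * ((1 + t) * (2 * δ) + 2 * (t * D)) ≤ R * (6 * (q * D)) :=
      mul_le_mul_of_nonneg_left (by nlinarith [mul_nonneg hq0 hD0.le]) (by linarith)
    nlinarith
  set A : ℝ := 6 * R * q * D / α with hA
  have hab : a + b ≤ A := by
    rw [hA, le_div_iff₀ hα]; linarith
  have hAD : A ≤ 0.1 * D := by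
    rw [hA, div_le_iff₀ hα]
    have h1 : 60 * (R * q) ≤ α := by
      nlinarith [mul_nonneg (zero_le_one.trans hR1) hq0]
    nlinarith
  have ha0 : 0 ≤ a := l2InfDist_nonneg _ _
  have hb0 : 0 ≤ b := l2InfDist_nonneg _ _
  -- Uniqueness already keeps `h'` within `0.1 * D` of the true simplex; this supplies the a priori
  -- bound `M` needed by the residual estimate.
  have hcD : ∀ j, ‖c j‖ ≤ 1.1 * D := fun j => by
    obtain ⟨y, hy, hd⟩ := exists_mem_convexHull_range_norm_sub h₀ (h' j)
    have h1 := infDist_le_l2InfDist h' (convexHull ℝ (Set.range h₀)) j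
    rw [hd] at h1
    have h2 := norm_sub_le_norm_sub_add_norm_sub (h' j) y z₀
    have h3 := hdiam y hy
    have h4 : ‖h' j - z₀‖ = (1 + t) * ‖c j‖ := by
      rw [hh', add_sub_cancel_left, norm_smul, Real.norm_of_nonneg (by linarith)]
      rfl
    have h5 : ‖c j‖ ≤ (1 + t) * ‖c j‖ := le_mul_of_one_le_left (norm_nonneg _) (by linarith)
    linarith
  have hhat_near : ∀ j, ‖h' j - hhat j‖ ≤ 8 * q * D := fun j => by
    have h1 := norm_sub_orthogonalProjectionOnto_le hcard (by linarith) hεμ hnear' j (hcD j)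
    have e : h' j - hhat j = t • (c j : E) - (hhat j - z₀ - c j) := by
      simp only [hh']
      module
    have h2 : ‖t • (c j : E)‖ ≤ t * (1.1 * D) := by
      rw [norm_smul, Real.norm_of_nonneg ht0]
      exact mul_le_mul_of_nonneg_left (hcD j) ht0
    have h3 : 2 * δ * (2 * (1.1 * D) / (μ - 2 * δ) + 1) = t * (2.2 * D) + 2 * δ := by
      rw [ht]; ring
    have h4 : t * D ≤ 2.07 * q * D := mul_le_mul_of_nonneg_right htq hD0.le
    have h5 := norm_sub_le (t • (c j : E)) (hhat j - z₀ - c j)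
    rw [← e] at h5
    rw [h3] at h1
    change ‖hhat j - z₀ - c j‖ ≤ _ at h1
    nlinarith [mul_nonneg hq0 hD0.le]
  exact ⟨hα1, h', hab, hhat_near⟩

/-- Each true archetype is close to an estimated one. -/
theorem exists_archetype_near [DecidableEq ι]
    (hcard : Fintype.card ι = Module.finrank ℝ S + 1) (hcard2 : 2 ≤ Fintype.card ι)
    {C : Set E} (hCc : IsCompact C) {h₀ hhat : ι → E} {z₀ : E} {α μ δ σ τ : ℝ}
    (hα : 0 < α) (hμ : 0 < μ) (hδ : 0 ≤ δ) (hσ : 0 < σ) (hτ : 0 ≤ τ)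
    (hC : C ⊆ convexHull ℝ (Set.range h₀))
    (hball : ∀ v ∈ S, ‖v‖ ≤ μ → z₀ + v ∈ C)
    (hup : ∀ w : ι → ℝ, ‖∑ k, w k • h₀ k‖ ≤ τ * √(∑ k, w k ^ 2))
    (hlow : ∀ w : ι → ℝ, σ * √(∑ k, w k ^ 2) ≤ ‖∑ k, w k • h₀ k‖)
    (huniq : ∀ h : ι → E, C ⊆ convexHull ℝ (Set.range h) →
      l2InfDist h₀ C + α * (l2InfDist h (convexHull ℝ (Set.range h₀)) +
        l2InfDist h₀ (convexHull ℝ (Set.range h))) ≤ l2InfDist h C)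
    (hnear : ∀ x ∈ C, ∃ π ∈ stdSimplex ℝ ι, ‖x - ∑ j, π j • hhat j‖ ≤ 2 * δ)
    (hest : l2InfDist hhat C ≤ l2InfDist h₀ C + √(Fintype.card ι) * (2 * δ))
    (hsmall : δ * (30 * (Fintype.card ι * √(Fintype.card ι))) ≤ α * μ) (l : ι) :
    ∃ j, ‖h₀ l - hhat j‖ ≤ 33 * (τ / σ) * √(Fintype.card ι) * (δ / μ) * τ / α := by
  have hι : Nonempty ι := ⟨l⟩
  set D : ℝ := √2 * τ with hDdef
  have hD := norm_sub_le_of_linear_bound hτ hup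
  obtain ⟨hα1, h', hab, hhat_near⟩ := exists_near_simplex hcard hcard2 hCc hα hμ hδ hC hball hD
    huniq hnear hest hsmall
  set R : ℝ := √(Fintype.card ι) with hR
  have hR1 : 1 ≤ R := Real.one_le_sqrt.2 (by exact_mod_cast one_le_two.trans hcard2)
  set q : ℝ := δ / μ with hq
  have hq0 : 0 ≤ q := div_nonneg hδ hμ.le
  have hD0 : 0 ≤ D := mul_nonneg (Real.sqrt_nonneg 2) hτ
  set A : ℝ := 6 * R * q * D / α with hA
  set a := l2InfDist h' (convexHull ℝ (Set.range h₀)) with ha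
  set b := l2InfDist h₀ (convexHull ℝ (Set.range h')) with hb
  have ha0 : 0 ≤ a := l2InfDist_nonneg _ _
  have hb0 : 0 ≤ b := l2InfDist_nonneg _ _
  obtain ⟨j, hj⟩ := exists_vertex_near hτ hσ hup hlow
    (infDist_le_l2InfDist h' (convexHull ℝ (Set.range h₀))) l
    (infDist_le_l2InfDist h₀ (convexHull ℝ (Set.range h')) l)
  refine ⟨j, ?_⟩
  -- Together with `α ≤ 1` and `R ≥ 1`, this lets the projection error `8 * q * D` be absorbed into
  -- the matching error: `(15 + 8) * 1.42 ≤ 33`.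
  have hκ : 1 ≤ τ / σ := by
    rw [one_le_div hσ]
    have := (hlow (Pi.single l 1)).trans (hup (Pi.single l 1))
    have e : ∑ k, (Pi.single l 1 : ι → ℝ) k ^ 2 = 1 := by
      simp [Pi.single_apply, ite_pow]
    rwa [e, Real.sqrt_one, mul_one, mul_one] at this
  set κ : ℝ := τ / σ with hκdef
  have hs2 : √2 ≤ 1.42 := by rw [Real.sqrt_le_left (by norm_num)]; norm_num
  have h1 : a + √2 * κ * (a + b) ≤ 2.5 * κ * A := by
    have hA0 : 0 ≤ A := by linarith
    have e1 : a ≤ κ * A := by nlinarith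
    have e2 : √2 * κ * (a + b) ≤ 1.42 * κ * A := by gcongr
    nlinarith [mul_nonneg (zero_le_one.trans hκ) hA0]
  have h2 : q * D ≤ κ * R * (q * D) / α := by
    rw [le_div_iff₀ hα]
    have : 0 ≤ q * D := mul_nonneg hq0 hD0
    have h3 : q * D * α ≤ q * D * 1 := mul_le_mul_of_nonneg_left hα1 this
    have h4 : 1 ≤ κ * R := one_le_mul_of_one_le_of_one_le hκ hR1
    nlinarith
  have h3 := hhat_near j
  have h4 := norm_sub_le_norm_sub_add_norm_sub (h₀ l) (h' j) (hhat j)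
  have h5 : 2.5 * κ * A = 15 * (κ * R * (q * D) / α) := by rw [hA]; ring
  have h6 : κ * R * (q * D) / α ≤ 1.42 * (κ * R * q * τ / α) := by
    have e : κ * R * (q * D) / α = √2 * (κ * R * q * τ / α) := by rw [hDdef]; ring
    rw [e]
    exact mul_le_mul_of_nonneg_right hs2 (by positivity)
  have h7 : 0 ≤ κ * R * q * τ / α := by positivity
  have h8 : 33 * κ * R * q * τ / α = 33 * (κ * R * q * τ / α) := by ring
  rw [h8]
  linarith

end

/-! ### Translation from matrices to point families -/

theorem exists_mem_convexHull_norm_sub_le {ι κ E : Type*} [Fintype ι] [NormedAddCommGroup E]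
    [NormedSpace ℝ E] {f : ι → E} {g : κ → E} {ε : ℝ}
    (hfg : ∀ i, ∃ y ∈ convexHull ℝ (Set.range g), ‖f i - y‖ ≤ ε) {x : E}
    (hx : x ∈ convexHull ℝ (Set.range f)) :
    ∃ y ∈ convexHull ℝ (Set.range g), ‖x - y‖ ≤ ε := by
  choose y hy hd using hfg
  obtain ⟨π, hπ, rfl⟩ := mem_convexHull_range_iff.1 hx
  refine ⟨∑ i, π i • y i, (convex_convexHull ℝ _).sum_mem (fun i _ => hπ.1 i) hπ.2
    fun i _ => hy i, ?_⟩
  rw [← Finset.sum_sub_distrib]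
  simp only [← smul_sub]
  exact norm_sum_smul_le hπ hd

theorem infDist_convexHull_le {ι κ E : Type*} [Fintype ι] [Nonempty ι] [NormedAddCommGroup E]
    [NormedSpace ℝ E] {f : ι → E} {g : κ → E} {ε : ℝ}
    (hfg : ∀ i, ∃ y ∈ convexHull ℝ (Set.range g), ‖f i - y‖ ≤ ε) (x : E) :
    infDist x (convexHull ℝ (Set.range g)) ≤ infDist x (convexHull ℝ (Set.range f)) + ε := by
  obtain ⟨p, hp, hd⟩ := exists_mem_convexHull_range_norm_sub f x
  obtain ⟨y, hy, hpy⟩ := exists_mem_convexHull_norm_sub_le hfg hp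
  rw [hd]
  exact (infDist_le_norm_sub hy).trans ((norm_sub_le_norm_sub_add_norm_sub x p y).trans
    (by linarith))

variable {m n r d k : ℕ}

theorem vecLoss_eq_infDist_sq (hm : m ≠ 0) (u : EuclideanSpace ℝ (Fin d))
    (V : Matrix (Fin m) (Fin d) ℝ) : vecLoss u V = infDist u (conv V) ^ 2 := by
  have : Nonempty (Fin m) := ⟨⟨0, Nat.pos_of_ne_zero hm⟩⟩
  refine IsLeast.csInf_eq ⟨?_, ?_⟩
  · obtain ⟨y, hy, hd⟩ := exists_mem_convexHull_range_norm_sub (rowVec V) u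
    obtain ⟨π, hπ, rfl⟩ := mem_convexHull_range_iff.1 hy
    exact ⟨π, hπ, by rw [conv, hd]; rfl⟩
  · rintro _ ⟨π, hπ, rfl⟩
    exact pow_le_pow_left₀ infDist_nonneg
      (infDist_le_norm_sub (sum_smul_mem_convexHull_range (rowVec V) hπ)) 2

theorem sqrt_matLoss (hm : m ≠ 0) (U : Matrix (Fin k) (Fin d) ℝ) (V : Matrix (Fin m) (Fin d) ℝ) :
    √(matLoss U V) = l2InfDist (rowVec U) (conv V) := by
  simp only [matLoss, vecLoss_eq_infDist_sq hm, l2InfDist]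

theorem vecLoss_le_sq_iff (hm : m ≠ 0) (u : EuclideanSpace ℝ (Fin d))
    (V : Matrix (Fin m) (Fin d) ℝ) {δ : ℝ} (hδ : 0 ≤ δ) :
    vecLoss u V ≤ δ ^ 2 ↔ ∃ y ∈ conv V, ‖u - y‖ ≤ δ := by
  have : Nonempty (Fin m) := ⟨⟨0, Nat.pos_of_ne_zero hm⟩⟩
  rw [vecLoss_eq_infDist_sq hm, sq_le_sq₀ infDist_nonneg hδ]
  constructor
  · intro h
    obtain ⟨y, hy, hd⟩ := exists_mem_convexHull_range_norm_sub (rowVec V) u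
    exact ⟨y, hy, hd ▸ h⟩
  · rintro ⟨y, hy, h⟩
    exact (infDist_le_norm_sub hy).trans h

theorem norm_rowVec_le_maxRowNorm (Z : Matrix (Fin n) (Fin d) ℝ) (i : Fin n) :
    ‖rowVec Z i‖ ≤ maxRowNorm Z :=
  le_ciSup (f := fun i => ‖rowVec Z i‖) (Set.finite_range _).bddAbove i

theorem maxRowNorm_nonneg (Z : Matrix (Fin n) (Fin d) ℝ) : 0 ≤ maxRowNorm Z :=
  Real.iSup_nonneg fun _ => norm_nonneg _

theorem rowVec_mul (W : Matrix (Fin n) (Fin r) ℝ) (H : Matrix (Fin r) (Fin d) ℝ) (i : Fin n) :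
    rowVec (W * H) i = ∑ j, W i j • rowVec H j := by
  ext k
  simp [rowVec, Matrix.mul_apply]

theorem rowVec_add (X Z : Matrix (Fin n) (Fin d) ℝ) (i : Fin n) :
    rowVec (X + Z) i = rowVec X i + rowVec Z i := rfl

theorem conv_mul_subset {W : Matrix (Fin n) (Fin r) ℝ} (hW : IsRowStochastic W)
    (H : Matrix (Fin r) (Fin d) ℝ) : conv (W * H) ⊆ conv H := by
  refine convexHull_min ?_ (convex_convexHull ℝ _)
  rintro _ ⟨i, rfl⟩
  rw [rowVec_mul]
  exact sum_smul_mem_convexHull_range _ (hW i)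

theorem adjoint_toEuclideanLin_apply (H : Matrix (Fin r) (Fin d) ℝ) (w : Fin r → ℝ) :
    (Matrix.toEuclideanLin H).adjoint (WithLp.toLp 2 w) = ∑ j, w j • rowVec H j := by
  rw [← Matrix.toEuclideanLin_conjTranspose_eq_adjoint]
  ext k
  simp [rowVec, Matrix.mulVec, dotProduct, mul_comm]

theorem rank_eq_of_linearIndependent {H : Matrix (Fin r) (Fin d) ℝ}
    (hH : LinearIndependent ℝ (rowVec H)) : H.rank = r := by
  have h : LinearIndependent ℝ H.row :=
    hH.map' (WithLp.linearEquiv 2 ℝ (Fin d → ℝ)).toLinearMap (LinearEquiv.ker _)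
  rw [h.rank_matrix, Fintype.card_fin]

theorem finrank_range_toEuclideanLin (H : Matrix (Fin r) (Fin d) ℝ) :
    Module.finrank ℝ (Matrix.toEuclideanLin H).range = H.rank :=
  (H.rank_eq_finrank_range_toLin (EuclideanSpace.basisFun (Fin r) ℝ).toBasis
    (EuclideanSpace.basisFun (Fin d) ℝ).toBasis).symm

theorem exists_toEuclideanLin_eq {H : Matrix (Fin r) (Fin d) ℝ}
    (hH : LinearIndependent ℝ (rowVec H)) (w : EuclideanSpace ℝ (Fin r)) :
    ∃ x, Matrix.toEuclideanLin H x = w := by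
  have : (Matrix.toEuclideanLin H).range = ⊤ := by
    apply Submodule.eq_top_of_finrank_eq
    rw [finrank_range_toEuclideanLin, rank_eq_of_linearIndependent hH, finrank_euclideanSpace_fin]
  exact LinearMap.range_eq_top.1 this w

/-- Independent rows make `H` surjective as a map to the weight space, so every `w` is some `H x`
and the bound for the adjoint on the range applies to it. -/
theorem norm_sum_smul_rowVec_le {H : Matrix (Fin r) (Fin d) ℝ}
    (hH : LinearIndependent ℝ (rowVec H)) (w : Fin r → ℝ) :
    ‖∑ k, w k • rowVec H k‖ ≤ sigmaMax H * √(∑ k, w k ^ 2) := by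
  obtain ⟨x, hx⟩ := exists_toEuclideanLin_eq hH (WithLp.toLp 2 w)
  have := norm_adjoint_apply_le (Matrix.toEuclideanLin H) x
  rw [hx, adjoint_toEuclideanLin_apply, EuclideanSpace.norm_eq (WithLp.toLp 2 w)] at this
  simp only [Real.norm_eq_abs, sq_abs] at this
  exact this

theorem le_norm_sum_smul_rowVec {H : Matrix (Fin r) (Fin d) ℝ}
    (hH : LinearIndependent ℝ (rowVec H)) (w : Fin r → ℝ) :
    sigmaMin H * √(∑ k, w k ^ 2) ≤ ‖∑ k, w k • rowVec H k‖ := by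
  obtain ⟨x, hx⟩ := exists_toEuclideanLin_eq hH (WithLp.toLp 2 w)
  have := le_norm_adjoint_apply (Matrix.toEuclideanLin H) x
  rw [hx, adjoint_toEuclideanLin_apply, EuclideanSpace.norm_eq (WithLp.toLp 2 w),
    finrank_range_toEuclideanLin] at this
  simp only [Real.norm_eq_abs, sq_abs] at this
  exact this

theorem sigmaMin_pos (hr : 0 < r) {H : Matrix (Fin r) (Fin d) ℝ}
    (hH : LinearIndependent ℝ (rowVec H)) : 0 < sigmaMin H := by
  rw [sigmaMin, LinearMap.singularValues_pos_iff_lt_finrank_range, finrank_range_toEuclideanLin,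
    rank_eq_of_linearIndependent hH]
  omega

theorem ContainsBall.exists_submodule {μ : ℝ} {C : Set (EuclideanSpace ℝ (Fin d))}
    (h : ContainsBall k μ C) :
    ∃ (z₀ : EuclideanSpace ℝ (Fin d)) (S : Submodule ℝ (EuclideanSpace ℝ (Fin d))),
      Module.finrank ℝ S = k ∧ ∀ v ∈ S, ‖v‖ ≤ μ → z₀ + v ∈ C := by
  obtain ⟨z₀, U, hU, hb⟩ := h
  have hcomp : ∀ b, (Matrix.toEuclideanLin U).adjoint (Matrix.toEuclideanLin U b) = b := fun b => by
    rw [← Matrix.toEuclideanLin_conjTranspose_eq_adjoint,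
      Matrix.conjTranspose_eq_transpose_of_trivial]
    ext i
    simp [Matrix.toLpLin_apply, Matrix.mulVec_mulVec, hU]
  have hnorm : ∀ b, ‖Matrix.toEuclideanLin U b‖ = ‖b‖ := fun b => by
    rw [← sq_eq_sq₀ (norm_nonneg _) (norm_nonneg _), ← real_inner_self_eq_norm_sq,
      ← LinearMap.adjoint_inner_left, hcomp, real_inner_self_eq_norm_sq]
  refine ⟨z₀, (Matrix.toEuclideanLin U).range, ?_, ?_⟩
  · rw [LinearMap.finrank_range_of_inj (Function.LeftInverse.injective hcomp),
      finrank_euclideanSpace_fin]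
  · rintro _ ⟨b, rfl⟩ hμ
    exact hb b (hnorm b ▸ hμ)

end Archetypal

/-! ### The main theorem -/

open Archetypal Metric in
theorem theorem1 {n r d : ℕ} (hr : 2 ≤ r)
    (X Z : Matrix (Fin n) (Fin d) ℝ) (W₀ : Matrix (Fin n) (Fin r) ℝ)
    (H₀ Hhat : Matrix (Fin r) (Fin d) ℝ) (α μ : ℝ)
    (hW₀ : Archetypal.IsRowStochastic W₀)
    (hH₀ : LinearIndependent ℝ (Archetypal.rowVec H₀))
    (hX : X = W₀ * H₀ + Z)
    (hα : 0 < α) (hunique : Archetypal.IsAlphaUnique α W₀ H₀)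
    (hμ : 0 < μ) (hradius : Archetypal.HasInternalRadius r μ (W₀ * H₀))
    (hHhat : Archetypal.IsEstimator X (Archetypal.maxRowNorm Z) Hhat)
    (hsmall : Archetypal.maxRowNorm Z ≤ α * μ / (30 * (r : ℝ) ^ (3 / 2 : ℝ))) :
    Archetypal.archLoss H₀ Hhat ≤
      Archetypal.Cstar H₀ μ ^ 2 * (r : ℝ) ^ 5 / α ^ 2 * Archetypal.maxRowNorm Z ^ 2 := by
  have hr0 : r ≠ 0 := by omega
  have hrpos : (0 : ℝ) < r := by exact_mod_cast Nat.pos_of_ne_zero hr0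
  have hr1 : (1 : ℝ) ≤ r := by exact_mod_cast one_le_two.trans hr
  obtain ⟨z₀, S, hS, hball⟩ := hradius.exists_submodule
  set C : Set (EuclideanSpace ℝ (Fin d)) := conv (W₀ * H₀) with hCdef
  -- Without data rows `C` would be empty, yet it contains the centre of the ball.
  have hn : Nonempty (Fin n) := by
    have hz : z₀ ∈ C := by simpa using hball 0 S.zero_mem (by simpa using hμ.le)
    exact Set.range_nonempty_iff_nonempty.1 (convexHull_nonempty_iff.1 ⟨z₀, hz⟩)
  have hn0 : n ≠ 0 := Fin.pos_iff_nonempty.2 hn |>.ne'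
  have hC : C ⊆ conv H₀ := conv_mul_subset hW₀ H₀
  set δ : ℝ := maxRowNorm Z with hδdef
  have hδ : 0 ≤ δ := maxRowNorm_nonneg Z
  have hXX₀ : ∀ i, ‖rowVec X i - rowVec (W₀ * H₀) i‖ ≤ δ := fun i => by
    rw [hX, rowVec_add, add_sub_cancel_left]
    exact norm_rowVec_le_maxRowNorm Z i
  have hX₀mem : ∀ i, rowVec (W₀ * H₀) i ∈ C := fun i => subset_convexHull ℝ _ ⟨i, rfl⟩
  have hXmem : ∀ i, rowVec X i ∈ conv X := fun i => subset_convexHull ℝ _ ⟨i, rfl⟩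
  obtain ⟨hfeas, hmin⟩ := hHhat
  have hnear : ∀ x ∈ C, ∃ π ∈ stdSimplex ℝ (Fin r), ‖x - ∑ j, π j • rowVec Hhat j‖ ≤ 2 * δ :=
    fun x hx => by
      obtain ⟨y, hy, hd⟩ := exists_mem_convexHull_norm_sub_le (g := rowVec Hhat) (ε := 2 * δ)
        (fun i => by
          obtain ⟨y, hy, hd⟩ := (vecLoss_le_sq_iff hr0 _ _ hδ).1 (hfeas i)
          have h1 := norm_sub_le_norm_sub_add_norm_sub (rowVec (W₀ * H₀) i) (rowVec X i) y
          have h2 := hXX₀ i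
          rw [norm_sub_rev] at h2
          exact ⟨y, hy, by linarith⟩) hx
      obtain ⟨π, hπ, rfl⟩ := mem_convexHull_range_iff.1 hy
      exact ⟨π, hπ, hd⟩
  have hfeas₀ : H₀ ∈ feasible r X δ := fun i =>
    (vecLoss_le_sq_iff hr0 _ _ hδ).2 ⟨_, hC (hX₀mem i), hXX₀ i⟩
  -- Optimality concerns the noisy hull; passing between it and `C` costs `δ` per point, once for
  -- each side.
  have hest : l2InfDist (rowVec Hhat) C ≤
      l2InfDist (rowVec H₀) C + √(Fintype.card (Fin r)) * (2 * δ) := by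
    have h1 : l2InfDist (rowVec Hhat) (conv X) ≤ l2InfDist (rowVec H₀) (conv X) := by
      rw [← sqrt_matLoss hn0, ← sqrt_matLoss hn0]
      exact Real.sqrt_le_sqrt (hmin hfeas₀)
    have h2 : l2InfDist (rowVec Hhat) C ≤ 1 * l2InfDist (rowVec Hhat) (conv X) +
        √(Fintype.card (Fin r)) * δ := l2InfDist_le zero_le_one hδ fun l => by
      rw [one_mul]
      exact infDist_convexHull_le (fun i => ⟨_, hX₀mem i, hXX₀ i⟩) _
    have h3 : l2InfDist (rowVec H₀) (conv X) ≤ 1 * l2InfDist (rowVec H₀) C +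
        √(Fintype.card (Fin r)) * δ := l2InfDist_le zero_le_one hδ fun l => by
      rw [one_mul]
      exact infDist_convexHull_le (fun i => ⟨_, hXmem i, by
        rw [norm_sub_rev]; exact hXX₀ i⟩) _
    linarith
  have huniq : ∀ h : Fin r → EuclideanSpace ℝ (Fin d), C ⊆ convexHull ℝ (Set.range h) →
      l2InfDist (rowVec H₀) C + α * (l2InfDist h (convexHull ℝ (Set.range (rowVec H₀))) +
        l2InfDist (rowVec H₀) (convexHull ℝ (Set.range h))) ≤ l2InfDist h C := fun h hh => by
    obtain ⟨H, rfl⟩ : ∃ H : Matrix (Fin r) (Fin d) ℝ, rowVec H = h :=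
      ⟨Matrix.of fun i => (h i).ofLp, rfl⟩
    have := hunique H hh
    rwa [sqrt_matLoss hn0, sqrt_matLoss hn0, sqrt_matLoss hr0, sqrt_matLoss hr0] at this
  have hsmall' : δ * (30 * (Fintype.card (Fin r) * √(Fintype.card (Fin r)))) ≤ α * μ := by
    have e : (r : ℝ) ^ (3 / 2 : ℝ) = r * √r := by
      rw [Real.sqrt_eq_rpow, ← Real.rpow_one_add' hrpos.le (by norm_num)]
      norm_num
    rw [Fintype.card_fin, ← e]
    exact (le_div_iff₀ (by positivity)).1 hsmall
  have hσ := sigmaMin_pos (Nat.pos_of_ne_zero hr0) hH₀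
  have hτ : 0 ≤ sigmaMax H₀ := (Matrix.toEuclideanLin H₀).singularValues_nonneg 0
  have hmain := exists_archetype_near (S := S) (by rw [hS, Fintype.card_fin]; omega)
    (by rwa [Fintype.card_fin]) ((Set.finite_range _).isCompact_convexHull ℝ) hα hμ hδ hσ hτ hC
    hball (norm_sum_smul_rowVec_le hH₀) (le_norm_sum_smul_rowVec hH₀) huniq hnear hest hsmall'
  rw [Fintype.card_fin] at hmain
  set B : ℝ := 33 * (sigmaMax H₀ / sigmaMin H₀) * √r * (δ / μ) * sigmaMax H₀ / α with hB
  have h1 : archLoss H₀ Hhat ≤ r * B ^ 2 := by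
    have : ∀ l, ⨅ l', sqLoss (rowVec H₀ l) (rowVec Hhat l') ≤ B ^ 2 := fun l => by
      obtain ⟨j, hj⟩ := hmain l
      exact (ciInf_le (Set.finite_range _).bddBelow j).trans
        (pow_le_pow_left₀ (norm_nonneg _) hj 2)
    refine (Finset.sum_le_sum fun l _ => this l).trans ?_
    simp
  refine h1.trans ?_
  have hm : kappa H₀ ^ 2 / r ≤ max 1 (kappa H₀ / √r) ^ 2 := by
    have h2 : kappa H₀ ^ 2 / r = (kappa H₀ / √r) ^ 2 := by
      rw [div_pow, Real.sq_sqrt hrpos.le]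
    rw [h2]
    exact pow_le_pow_left₀ (div_nonneg (div_nonneg hτ hσ.le) (Real.sqrt_nonneg _))
      (le_max_right _ _) 2
  set Q : ℝ := (δ / μ * sigmaMax H₀ / α) ^ 2 with hQ
  have hQ0 : 0 ≤ Q := sq_nonneg _
  have e1 : (r : ℝ) * B ^ 2 = 33 ^ 2 * (kappa H₀ ^ 2 * r ^ 2) * Q := by
    have : B = 33 * kappa H₀ * √r * (δ / μ * sigmaMax H₀ / α) := by rw [hB, kappa]; ring
    rw [this, mul_pow, mul_pow, mul_pow, Real.sq_sqrt hrpos.le]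
    ring
  have e2 : Cstar H₀ μ ^ 2 * (r : ℝ) ^ 5 / α ^ 2 * δ ^ 2 =
      120 ^ 2 * (max 1 (kappa H₀ / √r) ^ 2 * r ^ 5) * Q := by
    rw [Cstar, hQ]; ring
  rw [e1, e2]
  -- The bound obtained, with `33 ^ 2 * kappa H₀ ^ 2 * r ^ 2`, is stronger than the one stated; only
  -- `33 ≤ 120` and `r ^ 3 ≤ r ^ 5` are spent here.
  refine mul_le_mul_of_nonneg_right (mul_le_mul (by norm_num) ?_ (by positivity) (by norm_num)) hQ0
  calc kappa H₀ ^ 2 * (r : ℝ) ^ 2 = kappa H₀ ^ 2 / r * r ^ 3 := by field_simp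
    _ ≤ max 1 (kappa H₀ / √r) ^ 2 * r ^ 5 :=
        mul_le_mul hm (pow_le_pow_right₀ hr1 (by norm_num)) (by positivity) (sq_nonneg _)
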